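/- Let $n\ge 2$, $V=\mathbb{H}^n$ and let $W=\mathbb{H}^{n-1}\oplus\operatorname{Im}\mathbb{H}\subset V$ be the real hyperplane of vectors whose last coordinate is imaginary. Let $\tilde{\mathfrak g}=\mathfrak{gl}_n(\mathbb{H})\oplus\mathfrak{sp}_1\subset\mathfrak{gl}(V)$ (real endomorphisms), where $A\in\mathfrak{gl}_n(\mathbb{H})$ and $a\in\mathfrak{sp}_1=\operatorname{Im}\mathbb{H}$ act by $(A,a)\cdot v=Av-va$. Let $\tilde{\mathfrak g}_\infty=\bigoplus_{p\ge -1}\tilde{\mathfrak g}^p$ be the maximal transitive (Cartan) prolongation of $\tilde{\mathfrak g}$: $\tilde{\mathfrak g}^{-1}=V$, $\tilde{\mathfrak g}^0=\tilde{\mathfrak g}$ and, for $p\ge 1$, $\tilde{\mathfrak g}^p$ is the space of linear maps $T:V\to\tilde{\mathfrak g}^{p-1}$ with $T(v)(w)=T(w)(v)$ for all $v,w\in V$; equivalently, for $p\geq 0$, $\tilde{\mathfrak g}^{p}$ is the space of symmetric $(p+1)$-linear maps $V^{p+1}\to V$ which lie in $\tilde{\mathfrak g}$ whenever all arguments but one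 are fixed. The bracket of $T\in\tilde{\mathfrak g}^p$, $p\ge 0$, with $v\in V=\tilde{\mathfrak g}^{-1}$ is $[T,v]=T(v)$. For $p,q\ge 0$ let $C^{p,q}(\tilde{\mathfrak g},W)=\tilde{\mathfrak g}^{p-1}\otimes\Lambda^qW^*$ be the space of alternating $q$-linear maps $W^q\to\tilde{\mathfrak g}^{p-1}$, put $C^{p,q}(\tilde{\mathfrak g},W)=0$ if $p<0$ or $q<0$, and let $$\partial:C^{p,q}(\tilde{\mathfrak g},W)\to C^{p-1,q+1}(\tilde{\mathfrak g},W),\qquad \partial c(w_1,\dots,w_{q+1})=\sum_{i=1}^{q+1}(-1)^i\,[c(w_1,\dots,\widehat{w_i},\dots,w_{q+1}),w_i]$$ for $p\geq 1$, with $\partial=0$ on $C^{0,q}$. Then $\partial\circ\partial=0$; the generalized Spencer cohomology groups are $$H^{p,q}(\tilde{\mathfrak g},W)=\frac{\ker\big(\partial:C^{p,q}\to C^{p-1,q+1}\big)}{\partial\big(C^{p+1,q-1}\big)}.$$ Then: 1. $H^{p,0}(\tilde{\mathfrak g},W)=0$ and $H^{p,1}(\tilde{\mathfrak g},W)=0$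 for every $p\ge 1$. 2. $H^{0,0}(\tilde{\mathfrak g},W)\cong V$ as real vector spaces, the isomorphism sending the class of a cocycle $c\in C^{0,0}=V$ to $c$. 3. $H^{0,1}(\tilde{\mathfrak g},W)\cong (V\otimes W^*)/\tilde{\mathfrak g}|_W$ as real vector spaces, where $V\otimes W^*=\operatorname{Hom}_{\mathbb R}(W,V)$ and $\tilde{\mathfrak g}|_W=\{T|_W : T\in\tilde{\mathfrak g}\}$, the isomorphism sending the class of a cocycle $c\in C^{0,1}=\operatorname{Hom}_{\mathbb R}(W,V)$ to the class of $c$. -/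

import Mathlib

open scoped Quaternion

attribute [local instance] LieRing.ofAssociativeRing

noncomputable section

/-! ### Cartan prolongation and the generalized Spencer complex of a linear Lie algebra -/

section Spencer

variable {V : Type*} [AddCommGroup V] [Module ℝ V]

/-- The component `𝔤^{p-1}`, for `p ≥ 0`, of the maximal transitive prolongation
`𝔤_∞ = 𝔤^{-1} + 𝔤^0 + 𝔤^1 + ⋯` of a linear Lie algebra `𝔤^0 = 𝔤 ⊆ 𝔤𝔩(V)` with `𝔤^{-1} = V`:
the symmetric `p`-linear maps `T : V × ⋯ × V → V` such that, whenever all arguments but one are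
fixed, the remaining endomorphism of `V` lies in `𝔤`.
For `p = 0` there is no condition and `T` is a vector of `V`; for `p = 1`, `T` is an element
of `𝔤`; and for `p ≥ 1`, `𝔤^p` is the space of the linear maps `T : V → 𝔤^{p-1}` with
`T(v)(w) = T(w)(v)`. -/
def prolongation (𝔤 : LieSubalgebra ℝ (Module.End ℝ V)) (p : ℕ) :
    Submodule ℝ (MultilinearMap ℝ (fun _ : Fin p => V) V) where
  carrier := {T | (∀ (σ : Equiv.Perm (Fin p)) (v : Fin p → V), T (v ∘ σ) = T v) ∧
    ∀ (i : Fin p) (v : Fin p → V), T.toLinearMap v i ∈ 𝔤}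
  zero_mem' := ⟨fun _ _ => rfl, fun _ _ => 𝔤.zero_mem⟩
  add_mem' := fun hS hT =>
    ⟨fun σ v => congrArg₂ (· + ·) (hS.1 σ v) (hT.1 σ v),
      fun i v => 𝔤.add_mem (hS.2 i v) (hT.2 i v)⟩
  smul_mem' := fun c _ hT =>
    ⟨fun σ v => congrArg (c • ·) (hT.1 σ v), fun i v => 𝔤.smul_mem c (hT.2 i v)⟩

variable (𝔤 : LieSubalgebra ℝ (Module.End ℝ V))

theorem prolongation_curryLeft_mem {p : ℕ} (T : prolongation 𝔤 (p + 1)) (v : V) :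
    T.1.curryLeft v ∈ prolongation 𝔤 p := by
  refine ⟨fun σ w => ?_, fun i w => ?_⟩
  · have h := T.2.1 (Equiv.Perm.decomposeFin.symm (0, σ)) (Fin.cons v w)
    simp only [MultilinearMap.curryLeft_apply]
    rw [← h]
    congr 1
    funext j
    refine Fin.cases ?_ (fun j => ?_) j <;> simp
  · have h := T.2.2 i.succ (Fin.cons v w)
    convert h using 1
    ext x
    simp [MultilinearMap.curryLeft_apply, Fin.cons_update]

/-- The vector space `𝔤^{p-1}` as a type of its own (a plain synonym, which only serves to speed up
the search for its vector space structure). -/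
def Prolongation (p : ℕ) : Type _ := prolongation 𝔤 p

instance (p : ℕ) : AddCommGroup (Prolongation 𝔤 p) :=
  inferInstanceAs (AddCommGroup (prolongation 𝔤 p))

instance (p : ℕ) : Module ℝ (Prolongation 𝔤 p) :=
  inferInstanceAs (Module ℝ (prolongation 𝔤 p))

/-- The multilinear map underlying an element of `𝔤^{p-1}`. -/
def Prolongation.toMultilinear {𝔤 : LieSubalgebra ℝ (Module.End ℝ V)} {p : ℕ} (T : Prolongation 𝔤 p) :
    MultilinearMap ℝ (fun _ : Fin p => V) V := T.1

/-- The bracket `𝔤^p × 𝔤^{-1} → 𝔤^{p-1}` of `𝔤_∞`, `[T, v] = T(v, ·, …, ·)`; for `p = 0` this is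
the action of an endomorphism on a vector. -/
def prolongationBracket (p : ℕ) :
    V →ₗ[ℝ] Prolongation 𝔤 (p + 1) →ₗ[ℝ] Prolongation 𝔤 p where
  toFun v :=
    { toFun := fun T => ⟨T.1.curryLeft v, prolongation_curryLeft_mem 𝔤 T v⟩
      map_add' := fun _ _ => rfl
      map_smul' := fun _ _ => rfl }
  map_add' := fun v w => by
    ext T : 1
    exact Subtype.ext (T.1.curryLeft.map_add v w)
  map_smul' := fun c v => by
    ext T : 1
    exact Subtype.ext (T.1.curryLeft.map_smul c v)

variable (W : Submodule ℝ V)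

/-- The generalized `(p,q)`-cochains `C^{p,q}(𝔤, W) = 𝔤^{p-1} ⊗ Λ^q W*`, as alternating `q`-linear
maps on `W` with values in `𝔤^{p-1}`. -/
abbrev SpencerCochain (p q : ℕ) : Type _ := W [⋀^Fin q]→ₗ[ℝ] Prolongation 𝔤 p

/-- The value `c(w₁, …, w_q) ∈ 𝔤^{-1} = V` of a `(0,q)`-cochain, as a vector of `V`. -/
def spencerValue {q : ℕ} (c : SpencerCochain 𝔤 W 0 q) (w : Fin q → W) : V :=
  (c w).toMultilinear ![]

/-- For a cochain `c`, the map `w ↦ ((w₁, …, w_q) ↦ [c(w₁, …, w_q), w])`. -/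
def spencerBracket (p q : ℕ) :
    SpencerCochain 𝔤 W (p + 1) q →ₗ[ℝ] W →ₗ[ℝ] SpencerCochain 𝔤 W p q where
  toFun c :=
    { toFun := fun w => (prolongationBracket 𝔤 p (w : V)).compAlternatingMap c
      map_add' := fun w w' => by ext x : 1; simp
      map_smul' := fun a w => by ext x : 1; simp }
  map_add' := fun c c' => by ext w x : 2; simp
  map_smul' := fun a c => by ext w x : 2; simp

/-- The generalized Spencer operator `∂ : C^{p+1,q}(𝔤, W) → C^{p,q+1}(𝔤, W)`; see
`spencerD_apply` for its formula. -/
def spencerD (p q : ℕ) : SpencerCochain 𝔤 W (p + 1) q →ₗ[ℝ] SpencerCochain 𝔤 W p (q + 1) :=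
  -(AlternatingMap.alternatizeUncurryFinLM ∘ₗ spencerBracket 𝔤 W p q)

/-- `∂c(w₁, …, w_{q+1}) = ∑ (-1)^i [c(w₁, …, ŵ_i, …, w_{q+1}), w_i]`, the indices of the arguments
being shifted by one in the code. -/
theorem spencerD_apply (p q : ℕ) (c : SpencerCochain 𝔤 W (p + 1) q) (w : Fin (q + 1) → W) :
    spencerD 𝔤 W p q c w = ∑ i : Fin (q + 1), (-1 : ℝ) ^ ((i : ℕ) + 1) •
      prolongationBracket 𝔤 p (w i : V) (c (i.removeNth w)) := by
  simp only [spencerD, LinearMap.neg_apply, LinearMap.comp_apply,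
    AlternatingMap.alternatizeUncurryFinLM_apply, AlternatingMap.neg_apply,
    AlternatingMap.alternatizeUncurryFin_apply, ← Finset.sum_neg_distrib]
  refine Finset.sum_congr rfl fun i _ => ?_
  have h : (spencerBracket 𝔤 W p q c (w i)) (i.removeNth w) =
    prolongationBracket 𝔤 p (w i : V) (c (i.removeNth w)) := rfl
  rw [h]
  rcases Nat.even_or_odd (i : ℕ) with hi | hi
  · simp [hi.neg_one_pow, hi.add_one.neg_one_pow]
  · simp [hi.neg_one_pow, hi.add_one.neg_one_pow]

theorem prolongationBracket_comm (p : ℕ) (T : Prolongation 𝔤 (p + 2)) (v w : V) :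
    prolongationBracket 𝔤 p v (prolongationBracket 𝔤 (p + 1) w T) =
      prolongationBracket 𝔤 p w (prolongationBracket 𝔤 (p + 1) v T) := by
  refine Subtype.ext (MultilinearMap.ext fun u => ?_)
  change T.1 (Fin.cons w (Fin.cons v u)) = T.1 (Fin.cons v (Fin.cons w u))
  rw [← T.2.1 (Equiv.swap 0 1) (Fin.cons v (Fin.cons w u))]
  congr 1
  funext j
  refine Fin.cases ?_ (fun j => Fin.cases ?_ (fun j => ?_) j) j
  · simp
  · simp
  · have h0 : (j.succ.succ : Fin (p + 2)) ≠ 0 := Fin.succ_ne_zero _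
    have h1 : (j.succ.succ : Fin (p + 2)) ≠ 1 := fun h =>
      Fin.succ_ne_zero j (Fin.succ_injective _ h)
    simp [Equiv.swap_apply_of_ne_of_ne h0 h1]

/-- The generalized Spencer operators form a differential complex. -/
theorem spencerD_spencerD (p q : ℕ) (c : SpencerCochain 𝔤 W (p + 2) q) :
    spencerD 𝔤 W p (q + 1) (spencerD 𝔤 W (p + 1) q c) = 0 := by
  let F : W →ₗ[ℝ] W →ₗ[ℝ] SpencerCochain 𝔤 W p q := LinearMap.mk₂ ℝ
    (fun w w' => (prolongationBracket 𝔤 p (w : V) ∘ₗ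
      prolongationBracket 𝔤 (p + 1) (w' : V)).compAlternatingMap c)
    (fun w w' w'' => by ext x : 1; simp) (fun a w w' => by ext x : 1; simp)
    (fun w w' w'' => by ext x : 1; simp) (fun a w w' => by ext x : 1; simp)
  have hF : ∀ w w', F w w' = F w' w := by
    intro w w'
    ext x : 1
    exact prolongationBracket_comm 𝔤 p (c x) w w'
  have h : spencerBracket 𝔤 W p (q + 1)
      (AlternatingMap.alternatizeUncurryFinLM (spencerBracket 𝔤 W (p + 1) q c)) =
      AlternatingMap.alternatizeUncurryFinLM ∘ₗ F := by
    ext w x : 2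
    simp only [LinearMap.comp_apply, AlternatingMap.alternatizeUncurryFinLM_apply,
      AlternatingMap.alternatizeUncurryFin_apply]
    change prolongationBracket 𝔤 p (w : V) (AlternatingMap.alternatizeUncurryFin _ x) = _
    rw [AlternatingMap.alternatizeUncurryFin_apply, map_sum]
    refine Finset.sum_congr rfl fun i _ => ?_
    rw [map_zsmul]
    rfl
  simp only [spencerD, LinearMap.neg_apply, LinearMap.comp_apply, map_neg, neg_neg]
  rw [h]
  exact AlternatingMap.alternatizeUncurryFin_alternatizeUncurryFinLM_comp_of_symmetric hF

/-- The `(p,q)`-cocycles, the kernel of `∂ : C^{p,q} → C^{p-1,q+1}`; here `C^{-1,q+1} = 0`. -/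
def spencerCocycles : (p q : ℕ) → Submodule ℝ (SpencerCochain 𝔤 W p q)
  | 0, _ => ⊤
  | p + 1, q => LinearMap.ker (spencerD 𝔤 W p q)

/-- The `(p,q)`-coboundaries, the image of `∂ : C^{p+1,q-1} → C^{p,q}`; here `C^{p+1,-1} = 0`. -/
def spencerCoboundaries : (p q : ℕ) → Submodule ℝ (SpencerCochain 𝔤 W p q)
  | _, 0 => ⊥
  | p, q + 1 => LinearMap.range (spencerD 𝔤 W p q)

theorem spencerCoboundaries_le_spencerCocycles (p q : ℕ) :
    spencerCoboundaries 𝔤 W p q ≤ spencerCocycles 𝔤 W p q := by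
  rcases q with _ | q
  · exact bot_le
  rcases p with _ | p
  · exact le_top
  rintro _ ⟨c, rfl⟩
  exact spencerD_spencerD 𝔤 W p q c

/-- The generalized Spencer cohomology group `H^{p,q}(𝔤, W)`. -/
abbrev SpencerCohomology (p q : ℕ) : Type _ :=
  spencerCocycles 𝔤 W p q ⧸ (spencerCoboundaries 𝔤 W p q).submoduleOf (spencerCocycles 𝔤 W p q)

/-- The cohomology class of a cocycle. -/
def spencerClass (p q : ℕ) : spencerCocycles 𝔤 W p q →ₗ[ℝ] SpencerCohomology 𝔤 W p q :=
  Submodule.mkQ _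

/-- `𝔤|_W`, the space of the restrictions `A|_W : W → V` of the elements `A` of `𝔤`, a subspace of
`Hom(W, V) = V ⊗ W*`. -/
def restrictedAlgebra : Submodule ℝ (W →ₗ[ℝ] V) :=
  𝔤.toSubmodule.map (LinearMap.lcomp ℝ V W.subtype)

end Spencer

/-! ### The quaternionic case -/

/-- The Lie algebra `𝔤𝔩_n(ℍ) ⊕ 𝔰𝔭_1` in its defining action `(A, a) · v = A v - v a` on `V = ℍ^n`,
where `A` is a quaternionic `n × n` matrix and `a` an imaginary quaternion. -/
def quaternionicAlgebra (n : ℕ) : LieSubalgebra ℝ (Module.End ℝ (Fin n → ℍ[ℝ])) where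
  carrier := {T | ∃ (A : Matrix (Fin n) (Fin n) ℍ[ℝ]) (a : ℍ[ℝ]), a.re = 0 ∧
    ∀ (v : Fin n → ℍ[ℝ]) (i : Fin n), T v i = A.mulVec v i - v i * a}
  zero_mem' := ⟨0, 0, rfl, fun v i => by simp⟩
  add_mem' := by
    rintro S T ⟨A, a, ha, hS⟩ ⟨B, b, hb, hT⟩
    refine ⟨A + B, a + b, by simp [ha, hb], fun v i => ?_⟩
    simp only [LinearMap.add_apply, Pi.add_apply, hS, hT, Matrix.add_mulVec, mul_add]
    abel
  smul_mem' := by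
    rintro c T ⟨A, a, ha, hT⟩
    refine ⟨c • A, c • a, by simp [ha], fun v i => ?_⟩
    simp only [LinearMap.smul_apply, Pi.smul_apply, hT, Matrix.smul_mulVec, smul_sub, mul_smul_comm]
  lie_mem' := by
    rintro S T ⟨A, a, ha, hS⟩ ⟨B, b, hb, hT⟩
    refine ⟨A * B - B * A, a * b - b * a, by simp [ha, hb]; ring, fun v i => ?_⟩
    have hS' : ∀ v, S v = A.mulVec v - fun i => v i * a := fun v => funext (hS v)
    have hT' : ∀ v, T v = B.mulVec v - fun i => v i * b := fun v => funext (hT v)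
    have key : ∀ (C : Matrix (Fin n) (Fin n) ℍ[ℝ]) (v : Fin n → ℍ[ℝ]) (c : ℍ[ℝ]) (i : Fin n),
        C.mulVec (fun i => v i * c) i = C.mulVec v i * c := by
      intro C v c i
      simp [Matrix.mulVec, dotProduct, Finset.sum_mul, mul_assoc]
    simp only [LieRing.of_associative_ring_bracket, LinearMap.sub_apply, Module.End.mul_apply,
      hS', hT', Matrix.mulVec_sub, Matrix.sub_mulVec, Pi.sub_apply, key, sub_mul,
      ← Matrix.mulVec_mulVec, mul_sub, mul_assoc]
    abel

/-- The real hyperplane `W = ℍ^{n-1} ⊕ Im ℍ` of `V = ℍ^n`: the vectors whose last coordinate is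
imaginary. -/
def quaternionicHyperplane (n : ℕ) : Submodule ℝ (Fin n → ℍ[ℝ]) where
  carrier := {v | ∀ i : Fin n, (i : ℕ) + 1 = n → (v i).re = 0}
  zero_mem' := fun _ _ => rfl
  add_mem' := fun hv hw i hi => by simp [hv i hi, hw i hi]
  smul_mem' := fun c v hv i hi => by simp [hv i hi]

end

/-!
Write `V = ℍ^n`, `W = ℍ^{n-1} ⊕ Im ℍ`, and `𝔤` for the Lie algebra `𝔤𝔩_n(ℍ) ⊕ 𝔰𝔭_1`; the component
`𝔤^{p-1}` of its prolongation is `Prolongation 𝔤 p`. In degrees `(0,0)` and `(0,1)` every cochain is a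
cocycle, and the coboundaries are `0` and `𝔤|_W`, so the two isomorphisms are formal and hold for
any linear Lie algebra.

The vanishing of `H^{p,0}`, `p ≥ 1`, says that an element of `𝔤^{p-1}` whose bracket with `W` is zero
is itself zero. Since brackets with vectors commute, this follows by induction from `p = 1`
(`Prolongation.eq_zero_of_bracket_eq_zero`), where it says that an element of `𝔤` is determined by
its restriction to `W` (`eq_zero_of_mem_quaternionicAlgebra`).

The vanishing of `H^{p,1}` is the statement that a linear map `c : W → 𝔤^{p-1}` with
`[c(w), w'] = [c(w'), w]` extends to an element of `𝔤^p`.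

* For `p = 1`, write `c(w) v = A(w) v - v a(w)`. Comparing the vectors `e_i s` and `e_j q` of two
  different coordinate lines, in row `j`, gives an equation between quaternionic functions whose
  solutions are `a(e_i s) = -Im(ξ_i s)` (`Quaternion.exists_of_mul_sub_mul_eq`); it has no other
  solutions even if `s` and `q` are restricted to `Im ℍ`, which is what the last coordinate of `W`
  allows. Subtracting `T_ξ(w, v) = w (ξ v) + v (ξ w)` from `c` leaves a symmetric map with values in
  `𝔤𝔩_n(ℍ)`, and right `ℍ`-linearity forces it to be zero (`exists_eq_covectorBilin`). In
  particular `𝔤^1` consists of the maps `T_ξ`.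
* For `p = 2`, the values of `c` are thus of the form `T_{ξ(w)}`, and the symmetry of `c` on
  coordinate lines forces `ξ = 0` (`eq_zero_of_covectorBilin_comm`).
* The case `p = 2` applied to restrictions shows that `𝔤^2 = 0`, hence `𝔤^p = 0` for all `p ≥ 2`
  (`subsingleton_prolongation`), and nothing remains to be proved for `p ≥ 3`.
-/

/-! ### Functional equations over the quaternions -/

/-- The three imaginary units `i`, `j`, `k` of `ℍ`, indexed by `Fin 3`. -/
def imaginaryUnit (k : Fin 3) : ℍ[ℝ] :=
  ⟨0, if k = 0 then 1 else 0, if k = 1 then 1 else 0, if k = 2 then 1 else 0⟩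

@[simp] theorem imaginaryUnit_re (k : Fin 3) : (imaginaryUnit k).re = 0 := rfl

@[simp] theorem imaginaryUnit_imI (k : Fin 3) :
    (imaginaryUnit k).imI = if k = 0 then 1 else 0 := rfl

@[simp] theorem imaginaryUnit_imJ (k : Fin 3) :
    (imaginaryUnit k).imJ = if k = 1 then 1 else 0 := rfl

@[simp] theorem imaginaryUnit_imK (k : Fin 3) :
    (imaginaryUnit k).imK = if k = 2 then 1 else 0 := rfl

/-- Conjugation by each of `i`, `j`, `k` sends `x` to the same quaternion only when `x` is real. -/
theorem Quaternion.eq_coe_of_mul_imaginaryUnit_eq {x y : ℍ[ℝ]}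
    (h : ∀ k, x * imaginaryUnit k = imaginaryUnit k * y) :
    x = (x.re : ℍ[ℝ]) ∧ y = (x.re : ℍ[ℝ]) := by
  have hi := h 0
  have hj := h 1
  have hk := h 2
  simp [Quaternion.ext_iff] at hi hj hk
  obtain ⟨i1, i2, i3, i4⟩ := hi
  obtain ⟨j1, j2, j3, j4⟩ := hj
  obtain ⟨k1, k2, k3, k4⟩ := hk
  constructor <;> ext <;> simp <;> linarith

/-- A linear system of 36 real equations in 33 real unknowns. Writing `g q = q γ_q`, it says that
`γ_q s + a s = q⁻¹ (f s) q`; comparing components shows that `γ_q` does not depend on `q`. -/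
theorem Quaternion.eq_imaginaryUnit_mul_of_mul_sub_mul_eq {f a g : Fin 3 → ℍ[ℝ]}
    (ha : ∀ k, (a k).re = 0)
    (h : ∀ k l, f k * imaginaryUnit l - imaginaryUnit l * a k = g l * imaginaryUnit k) :
    ∃ ξ : ℍ[ℝ], ∀ k, g k = imaginaryUnit k * ξ := by
  have a0 := ha 0
  have a1 := ha 1
  have a2 := ha 2
  have h00 := h 0 0
  have h01 := h 0 1
  have h02 := h 0 2
  have h10 := h 1 0
  have h11 := h 1 1
  have h12 := h 1 2
  have h20 := h 2 0
  have h21 := h 2 1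
  have h22 := h 2 2
  simp [Quaternion.ext_iff, a0, a1, a2] at h00 h01 h02 h10 h11 h12 h20 h21 h22
  refine ⟨-(imaginaryUnit 0 * g 0), fun k => ?_⟩
  fin_cases k <;> ext <;> simp <;> linarith

/-- The functional equation for two distinct coordinates of a symmetric map `W → 𝔤𝔩_n(ℍ) ⊕ 𝔰𝔭_1`.
The predicates `P` and `Q` stand for the admissible values of the two coordinates of a vector of
`W`: all of `ℍ`, or only `Im ℍ` for the last coordinate. No additivity of `f`, `a`, `g` is
assumed. -/
theorem Quaternion.exists_of_mul_sub_mul_eq {P Q : ℍ[ℝ] → Prop} (hP : ∀ s : ℍ[ℝ], s.re = 0 → P s)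
    (hQ : ∀ q : ℍ[ℝ], q.re = 0 → Q q) {f a g : ℍ[ℝ] → ℍ[ℝ]} (ha : ∀ s, P s → (a s).re = 0)
    (h : ∀ s q, P s → Q q → f s * q - q * a s = g q * s) :
    ∃ ξ : ℍ[ℝ], ∀ s, P s → a s = -(ξ * s).im ∧ f s = ((ξ * s).re : ℍ[ℝ]) := by
  obtain ⟨ξ, hξ⟩ := Quaternion.eq_imaginaryUnit_mul_of_mul_sub_mul_eq
    (f := fun k => f (imaginaryUnit k)) (a := fun k => a (imaginaryUnit k))
    (g := fun k => g (imaginaryUnit k)) (fun k => ha _ (hP _ rfl))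
    (fun k l => h _ _ (hP _ rfl) (hQ _ rfl))
  refine ⟨ξ, fun s hs => ?_⟩
  obtain ⟨h1, h2⟩ := Quaternion.eq_coe_of_mul_imaginaryUnit_eq (x := f s) (y := ξ * s + a s)
    fun k => by
      rw [sub_eq_iff_eq_add.1 (h s (imaginaryUnit k) hs (hQ _ rfl)), hξ k, mul_add, mul_assoc]
  have h3 : (ξ * s).re = (f s).re := by
    have := congrArg QuaternionAlgebra.re h2
    simpa only [Quaternion.re_add, Quaternion.re_coe, ha s hs, add_zero] using this
  refine ⟨?_, by rw [h3, ← h1]⟩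
  rw [eq_neg_iff_add_eq_zero, ← sub_eq_zero.2 h2, ← h3, ← Quaternion.sub_re_self]
  abel

/-- The functional equation for symmetric maps with values in `𝔤𝔩_n(ℍ)` alone: such maps vanish
already on `Im ℍ`. -/
theorem Quaternion.eq_zero_of_mul_eq_mul {P Q : ℍ[ℝ] → Prop} (hP : ∀ s : ℍ[ℝ], s.re = 0 → P s)
    (hQ : ∀ q : ℍ[ℝ], q.re = 0 → Q q) {f g : ℍ[ℝ] → ℍ[ℝ]}
    (h : ∀ s q, P s → Q q → f s * q = g q * s) : ∀ s, P s → f s = 0 := by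
  obtain ⟨ξ, hξ⟩ := Quaternion.exists_of_mul_sub_mul_eq (a := fun _ => 0) hP hQ (fun _ _ => rfl)
    (fun s q hs hq => by simpa using h s q hs hq)
  have h0 : ξ = 0 := by
    have hi := (hξ (imaginaryUnit 0) (hP _ rfl)).1
    have hj := (hξ (imaginaryUnit 1) (hP _ rfl)).1
    simp [Quaternion.ext_iff] at hi hj
    ext <;> simp <;> linarith
  intro s hs
  simpa [h0] using (hξ s hs).2

/-- If `i f`, `j f` and `k f` are all real, then `f = 0`. -/
theorem Quaternion.eq_zero_of_imaginaryUnit_mul_comm {f : ℍ[ℝ]}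
    (h : ∀ k l, imaginaryUnit k * f * imaginaryUnit l = imaginaryUnit l * (imaginaryUnit k * f)) :
    f = 0 := by
  have hi := (Quaternion.eq_coe_of_mul_imaginaryUnit_eq (h 0)).1
  have hj := (Quaternion.eq_coe_of_mul_imaginaryUnit_eq (h 1)).1
  simp [Quaternion.ext_iff] at hi hj
  ext <;> simp <;> linarith

section Quaternionic

variable {n : ℕ}

/-! ### The hyperplane `ℍ^{n-1} ⊕ Im ℍ` -/

theorem single_mem_quaternionicHyperplane (i : Fin n) {s : ℍ[ℝ]} (hs : s.re = 0) :
    Pi.single i s ∈ quaternionicHyperplane n := by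
  intro j _
  rcases eq_or_ne j i with rfl | h
  · simpa using hs
  · simp [h]

/-- `W` is spanned by the vectors of `W` with a single non-zero coordinate. -/
theorem LinearMap.eq_zero_of_mem_quaternionicHyperplane {E : Type*} [AddCommGroup E] [Module ℝ E]
    (F : (Fin n → ℍ[ℝ]) →ₗ[ℝ] E)
    (hF : ∀ i s, Pi.single i s ∈ quaternionicHyperplane n → F (Pi.single i s) = 0)
    {w : Fin n → ℍ[ℝ]} (hw : w ∈ quaternionicHyperplane n) : F w = 0 := by
  rw [← Finset.univ_sum_single w, map_sum]
  refine Finset.sum_eq_zero fun i _ => hF i _ fun j hj => ?_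
  rcases eq_or_ne j i with rfl | h
  · simpa using hw j hj
  · simp [h]

theorem apply_single_of_eq_mulVec_sub {T : Module.End ℝ (Fin n → ℍ[ℝ])}
    {A : Matrix (Fin n) (Fin n) ℍ[ℝ]} {a : ℍ[ℝ]}
    (hT : ∀ (v : Fin n → ℍ[ℝ]) (i : Fin n), T v i = A.mulVec v i - v i * a)
    (j : Fin n) (q : ℍ[ℝ]) (k : Fin n) :
    T (Pi.single j q) k = A k j * q - (Pi.single j q : Fin n → ℍ[ℝ]) k * a := by
  rw [hT]
  simp [Matrix.mulVec_single]

/-- An element of `𝔤𝔩_n(ℍ) ⊕ 𝔰𝔭_1` is determined by its restriction to `W`. -/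
theorem eq_zero_of_mem_quaternionicAlgebra {T : Module.End ℝ (Fin n → ℍ[ℝ])}
    (hT : T ∈ quaternionicAlgebra n) (h0 : ∀ w ∈ quaternionicHyperplane n, T w = 0) : T = 0 := by
  obtain ⟨A, a, ha, hA⟩ := hT
  have key := apply_single_of_eq_mulVec_sub hA
  have hz : ∀ j q k, q.re = 0 → A k j * q = (Pi.single j q : Fin n → ℍ[ℝ]) k * a := by
    intro j q k hq
    rw [← sub_eq_zero, ← key, h0 _ (single_mem_quaternionicHyperplane j hq), Pi.zero_apply]
  have hdiag : ∀ j : Fin n, A j j = 0 ∧ a = 0 := by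
    intro j
    obtain ⟨h1, h2⟩ := Quaternion.eq_coe_of_mul_imaginaryUnit_eq (x := A j j) (y := a)
      fun l => by simpa using hz j (imaginaryUnit l) j rfl
    have h3 : (A j j).re = 0 := ((congrArg QuaternionAlgebra.re h2).symm.trans ha :)
    rw [h3] at h1 h2
    exact ⟨by simpa using h1, by simpa using h2⟩
  have hA0 : ∀ k j, A k j = 0 := by
    intro k j
    rcases eq_or_ne k j with rfl | hkj
    · exact (hdiag k).1
    · have := hz j (imaginaryUnit 0) k rfl
      rw [Pi.single_eq_of_ne hkj, zero_mul, mul_eq_zero] at this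
      refine this.resolve_right fun h => ?_
      simpa using congrArg QuaternionAlgebra.imI h
  refine LinearMap.pi_ext fun j q => funext fun k => ?_
  rw [key, hA0, (hdiag j).2]
  simp

/-! ### Symmetric maps into `𝔤𝔩_n(ℍ) ⊕ 𝔰𝔭_1` and into its first prolongation -/

/-- The symmetric bilinear map `(v, w) ↦ v (ξ w) + w (ξ v)` of `ℍ^n` attached to a row vector `ξ`,
an element of the first prolongation of `𝔤𝔩_n(ℍ) ⊕ 𝔰𝔭_1`. -/
noncomputable def covectorBilin (ξ : Fin n → ℍ[ℝ]) :
    (Fin n → ℍ[ℝ]) →ₗ[ℝ] Module.End ℝ (Fin n → ℍ[ℝ]) :=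
  LinearMap.mk₂ ℝ (fun v w i => v i * (ξ ⬝ᵥ w) + w i * (ξ ⬝ᵥ v))
    (fun v v' w => by ext1 i; simp [add_mul, mul_add]; abel)
    (fun c v w => by ext1 i; simp [dotProduct_smul])
    (fun v w w' => by ext1 i; simp [add_mul, mul_add]; abel)
    (fun c v w => by ext1 i; simp [dotProduct_smul])

theorem covectorBilin_apply (ξ v w : Fin n → ℍ[ℝ]) (i : Fin n) :
    covectorBilin ξ v w i = v i * (ξ ⬝ᵥ w) + w i * (ξ ⬝ᵥ v) := rfl

theorem covectorBilin_comm (ξ v w : Fin n → ℍ[ℝ]) :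
    covectorBilin ξ v w = covectorBilin ξ w v :=
  funext fun _ => add_comm _ _

theorem covectorBilin_mem (ξ v : Fin n → ℍ[ℝ]) : covectorBilin ξ v ∈ quaternionicAlgebra n := by
  refine ⟨Matrix.vecMulVec v ξ + ((ξ ⬝ᵥ v).re : ℝ) • (1 : Matrix (Fin n) (Fin n) ℍ[ℝ]),
    -(ξ ⬝ᵥ v).im, by simp, fun w i => ?_⟩
  have h : (ξ ⬝ᵥ v) = ((ξ ⬝ᵥ v).re : ℍ[ℝ]) + (ξ ⬝ᵥ v).im := (Quaternion.re_add_im _).symm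
  rw [covectorBilin_apply, Matrix.add_mulVec, Matrix.smul_mulVec, Matrix.one_mulVec, Pi.add_apply,
    Pi.smul_apply]
  have h1 : (Matrix.vecMulVec v ξ).mulVec w i = v i * (ξ ⬝ᵥ w) := by
    simp [Matrix.mulVec, Matrix.vecMulVec_apply, dotProduct, Finset.mul_sum, mul_assoc]
  have h2 : w i * (ξ ⬝ᵥ v) = (ξ ⬝ᵥ v).re • w i + w i * (ξ ⬝ᵥ v).im := by
    conv_lhs => rw [h, mul_add, Quaternion.mul_coe_eq_smul]
  rw [h1, h2, mul_neg, sub_neg_eq_add, add_assoc]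

/-- A linear map `W → 𝔤𝔩_n(ℍ) ⊕ 𝔰𝔭_1` which is symmetric on `W` is the restriction of an element
`covectorBilin ξ` of the first prolongation. The map is given through a linear extension `C` to `V`,
which enters only through its values on `W`. -/
theorem exists_eq_covectorBilin (hn : 2 ≤ n)
    (C : (Fin n → ℍ[ℝ]) →ₗ[ℝ] Module.End ℝ (Fin n → ℍ[ℝ]))
    (hC : ∀ w ∈ quaternionicHyperplane n, C w ∈ quaternionicAlgebra n)
    (hs : ∀ w ∈ quaternionicHyperplane n, ∀ w' ∈ quaternionicHyperplane n, C w w' = C w' w) :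
    ∃ ξ, ∀ w ∈ quaternionicHyperplane n, C w = covectorBilin ξ w := by
  have hC' : ∀ w, w ∈ quaternionicHyperplane n →
    ∃ (A : Matrix (Fin n) (Fin n) ℍ[ℝ]) (a : ℍ[ℝ]), a.re = 0 ∧
      ∀ (v : Fin n → ℍ[ℝ]) (i : Fin n), C w v i = A.mulVec v i - v i * a := hC
  choose! A a ha hA using hC'
  have key := fun w hw => apply_single_of_eq_mulVec_sub (hA w hw)
  have him : ∀ (i : Fin n) (s : ℍ[ℝ]), s.re = 0 → Pi.single i s ∈ quaternionicHyperplane n :=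
    fun i _ => single_mem_quaternionicHyperplane i
  -- The `𝔰𝔭_1`-part of `C` on the `i`-th coordinate line is found by evaluating symmetry on the
  -- vectors `e_i s` and `e_j q`, `j ≠ i`, in the `j`-th coordinate.
  have hξ : ∀ i : Fin n, ∃ ξ : ℍ[ℝ], ∀ s, Pi.single i s ∈ quaternionicHyperplane n →
      a (Pi.single i s) = -(ξ * s).im := by
    intro i
    have : Nontrivial (Fin n) := Fin.nontrivial_iff_two_le.2 hn
    obtain ⟨j, hij⟩ := exists_ne i
    obtain ⟨ξ, hξ⟩ := Quaternion.exists_of_mul_sub_mul_eq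
      (f := fun s => A (Pi.single i s) j j) (a := fun s => a (Pi.single i s))
      (g := fun q => A (Pi.single j q) j i) (him i) (him j) (fun s hs => ha _ hs)
      (fun s q hP hQ => by
        have := congrFun (hs _ hP _ hQ) j
        rw [key _ hP, key _ hQ] at this
        simpa [hij] using this)
    exact ⟨ξ, fun s hP => (hξ s hP).1⟩
  choose ξ hξ using hξ
  refine ⟨ξ, fun w hw => ?_⟩
  let B := C - covectorBilin ξ
  have hB : ∀ v w, B v w = C v w - covectorBilin ξ v w := fun _ _ => rfl
  -- The choice of `ξ` cancels the `𝔰𝔭_1`-part: `B (e_i s)` is right `ℍ`-linear.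
  have hlin : ∀ i s, Pi.single i s ∈ quaternionicHyperplane n →
      ∃ M : Fin n → Fin n → ℍ[ℝ], ∀ j q k, B (Pi.single i s) (Pi.single j q) k = M k j * q := by
    intro i s hi
    refine ⟨fun k j => A (Pi.single i s) k j - (Pi.single i s : Fin n → ℍ[ℝ]) k * ξ j -
      (Pi.single j ((ξ i * s).re : ℍ[ℝ]) : Fin n → ℍ[ℝ]) k, fun j q k => ?_⟩
    rw [hB, Pi.sub_apply, key _ hi, covectorBilin_apply, hξ i s hi, dotProduct_single,
      dotProduct_single, mul_neg, sub_neg_eq_add, sub_mul, sub_mul]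
    have : (Pi.single j q : Fin n → ℍ[ℝ]) k * (ξ i * s) =
        (Pi.single j ((ξ i * s).re : ℍ[ℝ]) : Fin n → ℍ[ℝ]) k * q +
          (Pi.single j q : Fin n → ℍ[ℝ]) k * (ξ i * s).im := by
      rcases eq_or_ne k j with rfl | h
      · conv_lhs => rw [← Quaternion.re_add_im (ξ i * s)]
        rw [Pi.single_eq_same, Pi.single_eq_same, mul_add, Quaternion.mul_coe_eq_smul,
          Quaternion.coe_mul_eq_smul]
      · simp [h]
    rw [this, mul_assoc]
    abel
  choose! M hM using hlin
  have hM0 : ∀ i s, Pi.single i s ∈ quaternionicHyperplane n → ∀ k j, M i s k j = 0 := by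
    intro i s hi k j
    refine Quaternion.eq_zero_of_mul_eq_mul (f := fun s => M i s k j) (g := fun q => M j q k i)
      (him i) (him j) (fun s q hP hQ => ?_) s hi
    rw [← hM i s hP, ← hM j q hQ, hB, hB, hs _ hP _ hQ, covectorBilin_comm]
  have hB0 : B w = 0 := by
    refine B.eq_zero_of_mem_quaternionicHyperplane (fun i s hi => ?_) hw
    refine LinearMap.pi_ext fun j q => funext fun k => ?_
    rw [hM i s hi, hM0 i s hi, zero_mul]
    rfl
  exact sub_eq_zero.1 hB0

/-- If the map `w ↦ covectorBilin (ξ w)` into the first prolongation is symmetric on `W`, then `ξ`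
vanishes on the vectors of `W` with a single non-zero coordinate. -/
theorem eq_zero_of_covectorBilin_comm (hn : 2 ≤ n) {ξ : (Fin n → ℍ[ℝ]) → Fin n → ℍ[ℝ]}
    (hs : ∀ w ∈ quaternionicHyperplane n, ∀ w' ∈ quaternionicHyperplane n,
      covectorBilin (ξ w) w' = covectorBilin (ξ w') w)
    (i : Fin n) (s : ℍ[ℝ]) (hi : Pi.single i s ∈ quaternionicHyperplane n) :
    ξ (Pi.single i s) = 0 := by
  have him : ∀ (i : Fin n) (s : ℍ[ℝ]), s.re = 0 → Pi.single i s ∈ quaternionicHyperplane n :=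
    fun i _ => single_mem_quaternionicHyperplane i
  have key : ∀ i s j q, Pi.single i s ∈ quaternionicHyperplane n →
      Pi.single j q ∈ quaternionicHyperplane n → ∀ k r,
      (Pi.single j q : Fin n → ℍ[ℝ]) k * (ξ (Pi.single i s) k * r) +
        r * (ξ (Pi.single i s) j * q) =
      (Pi.single i s : Fin n → ℍ[ℝ]) k * (ξ (Pi.single j q) k * r) +
        r * (ξ (Pi.single j q) i * s) := by
    intro i s j q hi hj k r
    have := congrFun (LinearMap.congr_fun (hs _ hi _ hj) (Pi.single k r)) k
    simpa only [covectorBilin_apply, dotProduct_single, Pi.single_eq_same] using this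
  funext j
  rcases eq_or_ne j i with rfl | hji
  -- A row `k ≠ j` isolates the coefficients of `ξ` along the coordinate line itself.
  · refine Quaternion.eq_zero_of_mul_eq_mul (f := fun s => ξ (Pi.single j s) j)
      (g := fun q => ξ (Pi.single j q) j) (him j) (him j) (fun s q hP hQ => ?_) s hi
    have : Nontrivial (Fin n) := Fin.nontrivial_iff_two_le.2 hn
    obtain ⟨k, hk⟩ := exists_ne j
    simpa [hk] using key j s j q hP hQ k 1
  -- In row `j`, testing on `e_j` and `e_j r` shows that `q * ξ (e_i s) j` commutes with `r`.
  · refine Quaternion.eq_zero_of_imaginaryUnit_mul_comm fun k l => ?_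
    set q := imaginaryUnit k
    have h1 := key i s j q hi (him j _ rfl) j 1
    have h2 := key i s j q hi (him j _ rfl) j (imaginaryUnit l)
    simp only [Pi.single_eq_same, Pi.single_eq_of_ne hji, zero_mul, zero_add, one_mul,
      mul_one] at h1 h2
    rw [← h1, mul_add] at h2
    rw [mul_assoc]
    exact add_right_cancel h2

end Quaternionic

/-! ### The low components of a prolongation -/

section Prolongation

variable {V : Type*} [AddCommGroup V] [Module ℝ V] (𝔤 : LieSubalgebra ℝ (Module.End ℝ V))

/-- The component `𝔤^{-1}` of the prolongation is `V`. -/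
def prolongationZeroEquiv : Prolongation 𝔤 0 ≃ₗ[ℝ] V where
  toFun T := T.toMultilinear ![]
  map_add' _ _ := rfl
  map_smul' _ _ := rfl
  invFun v := ⟨MultilinearMap.constOfIsEmpty ℝ _ v, fun _ _ => rfl, fun i => i.elim0⟩
  left_inv T := Subtype.ext <| MultilinearMap.ext fun x => by
    rw [Subsingleton.elim x ![]]
    rfl
  right_inv _ := rfl

/-- The component `𝔤^0` of the prolongation, as a space of endomorphisms of `V`. -/
def prolongationOneToEnd : Prolongation 𝔤 1 →ₗ[ℝ] Module.End ℝ V where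
  toFun T := T.toMultilinear.toLinearMap 0 0
  map_add' _ _ := rfl
  map_smul' _ _ := rfl

variable {𝔤}

theorem prolongationOneToEnd_apply (T : Prolongation 𝔤 1) (v : V) :
    prolongationOneToEnd 𝔤 T v = prolongationZeroEquiv 𝔤 (prolongationBracket 𝔤 0 v T) := by
  change T.1 _ = T.1 _
  congr 1
  funext j
  rw [Subsingleton.elim j 0]
  simp

theorem prolongationOneToEnd_mem (T : Prolongation 𝔤 1) : prolongationOneToEnd 𝔤 T ∈ 𝔤 :=
  T.2.2 0 0

theorem Prolongation.ext_bracket {p : ℕ} {S T : Prolongation 𝔤 (p + 1)}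
    (h : ∀ v, prolongationBracket 𝔤 p v S = prolongationBracket 𝔤 p v T) : S = T := by
  refine Subtype.ext (MultilinearMap.ext fun x => ?_)
  have := congrArg (fun R : Prolongation 𝔤 p => R.toMultilinear (Fin.tail x)) (h (x 0))
  change S.1 (Fin.cons (x 0) (Fin.tail x)) = T.1 (Fin.cons (x 0) (Fin.tail x)) at this
  rwa [Fin.cons_self_tail] at this

theorem prolongationOneToEnd_injective : Function.Injective (prolongationOneToEnd 𝔤) := by
  intro S T h
  refine Prolongation.ext_bracket fun v => (prolongationZeroEquiv 𝔤).injective ?_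
  rw [← prolongationOneToEnd_apply, ← prolongationOneToEnd_apply, h]

theorem exists_prolongationOneToEnd_eq {A : Module.End ℝ V} (hA : A ∈ 𝔤) :
    ∃ T, prolongationOneToEnd 𝔤 T = A := by
  refine ⟨⟨MultilinearMap.ofSubsingleton ℝ V V (0 : Fin 1) A, fun σ v => ?_, fun i v => ?_⟩, ?_⟩
  · rw [Subsingleton.elim σ 1]
    rfl
  · convert hA using 1
    ext x
    rw [Subsingleton.elim i 0]
    simp
  · ext x
    change (MultilinearMap.ofSubsingleton ℝ V V (0 : Fin 1) A) (Function.update 0 0 x) = A x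
    simp

/-- A symmetric bilinear map `V × V → V`, given as a map `C : V → 𝔤`, is an element of `𝔤^1`. -/
theorem exists_prolongation_two_eq (C : V →ₗ[ℝ] Module.End ℝ V) (hC : ∀ v, C v ∈ 𝔤)
    (hs : ∀ v w, C v w = C w v) :
    ∃ T : Prolongation 𝔤 2, ∀ v, prolongationOneToEnd 𝔤 (prolongationBracket 𝔤 1 v T) = C v := by
  let F : MultilinearMap ℝ (fun _ : Fin 2 => V) V := LinearMap.uncurryLeft
    ((MultilinearMap.ofSubsingletonₗ ℝ ℝ V V (0 : Fin 1)).toLinearMap ∘ₗ C)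
  have hfin : ∀ k : Fin 2, k = 0 ∨ k = 1 := by decide
  have hF : ∀ x, F x = C (x 0) (x 1) := fun _ => rfl
  refine ⟨⟨F, fun σ x => ?_, fun i x => ?_⟩, fun v => ?_⟩
  · rw [hF, hF, Function.comp_apply, Function.comp_apply]
    have h01 : σ 0 ≠ σ 1 := σ.injective.ne (by decide)
    rcases hfin (σ 0) with h0 | h0 <;>
      rcases hfin (σ 1) with h1 | h1 <;> rw [h0, h1] at h01 ⊢
    · exact absurd rfl h01
    · exact hs _ _
    · exact absurd rfl h01
  · rcases hfin i with rfl | rfl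
    · convert hC (x 1) using 1
      ext v
      simp [hF, hs v]
    · convert hC (x 0) using 1
      ext v
      simp [hF]
  · ext w
    change F _ = C v w
    rw [hF]
    simp

variable (W : Submodule ℝ V)

/-- If no non-zero element of `𝔤` vanishes on `W`, then no non-zero element of a higher component
of the prolongation does. -/
theorem Prolongation.eq_zero_of_bracket_eq_zero
    (h𝔤 : ∀ A ∈ 𝔤, (∀ w ∈ W, A w = 0) → A = 0) {p : ℕ} {T : Prolongation 𝔤 (p + 1)}
    (hT : ∀ w ∈ W, prolongationBracket 𝔤 p w T = 0) : T = 0 := by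
  induction p with
  | zero =>
    refine prolongationOneToEnd_injective ?_
    rw [map_zero]
    refine h𝔤 _ (prolongationOneToEnd_mem T) fun w hw => ?_
    rw [prolongationOneToEnd_apply, hT w hw, map_zero]
  | succ p ih =>
    refine Prolongation.ext_bracket fun v => ?_
    rw [map_zero]
    refine ih fun w hw => ?_
    rw [prolongationBracket_comm, hT w hw, map_zero]

/-! ### Spencer cochains of degree `q ≤ 1` -/

theorem spencerD_zero_apply (p : ℕ) (c : SpencerCochain 𝔤 W (p + 1) 0) (w : Fin 1 → W) :
    spencerD 𝔤 W p 0 c w = -prolongationBracket 𝔤 p (w 0 : V) (c ![]) := by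
  rw [spencerD_apply, Fin.sum_univ_one, Subsingleton.elim ((0 : Fin 1).removeNth w) ![]]
  simp

theorem spencerD_one_apply (p : ℕ) (c : SpencerCochain 𝔤 W (p + 1) 1) (w : Fin 2 → W) :
    spencerD 𝔤 W p 1 c w = prolongationBracket 𝔤 p (w 1 : V) (c ![w 0]) -
      prolongationBracket 𝔤 p (w 0 : V) (c ![w 1]) := by
  have h0 : (0 : Fin 2).removeNth w = ![w 1] := by ext i; fin_cases i; rfl
  have h1 : (1 : Fin 2).removeNth w = ![w 0] := by ext i; fin_cases i; rfl
  rw [spencerD_apply, Fin.sum_univ_two, h0, h1]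
  simp
  abel

variable (𝔤) in
/-- The identification of `C^{p,1}` with the space of linear maps from `W` to `𝔤^{p-1}`. -/
def spencerOneEquiv (p : ℕ) : SpencerCochain 𝔤 W p 1 ≃ₗ[ℝ] (W →ₗ[ℝ] Prolongation 𝔤 p) where
  __ := (AlternatingMap.ofSubsingleton ℝ W (Prolongation 𝔤 p) (0 : Fin 1)).symm
  map_add' _ _ := rfl
  map_smul' _ _ := rfl

theorem spencerOneEquiv_apply {p : ℕ} (c : SpencerCochain 𝔤 W p 1) (w : W) :
    spencerOneEquiv 𝔤 W p c w = c ![w] :=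
  congrArg c (Matrix.const_fin1_eq w)

theorem mem_spencerCoboundaries_one_iff {p : ℕ} {c : SpencerCochain 𝔤 W p 1} :
    c ∈ spencerCoboundaries 𝔤 W p 1 ↔
      ∃ T : Prolongation 𝔤 (p + 1), ∀ w : W, c ![w] = prolongationBracket 𝔤 p w T := by
  constructor
  · rintro ⟨b, rfl⟩
    refine ⟨-b ![], fun w => ?_⟩
    rw [spencerD_zero_apply, map_neg]
    rfl
  · rintro ⟨T, hT⟩
    refine ⟨AlternatingMap.constOfIsEmpty ℝ W (Fin 0) (-T), ?_⟩
    ext w : 1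
    rw [spencerD_zero_apply, show w = ![w 0] by ext i; fin_cases i; rfl, hT]
    simp

theorem subsingleton_spencerCohomology_zero (h𝔤 : ∀ A ∈ 𝔤, (∀ w ∈ W, A w = 0) → A = 0) (p : ℕ) :
    Subsingleton (SpencerCohomology 𝔤 W (p + 1) 0) := by
  refine Submodule.Quotient.subsingleton_iff.2 (Submodule.submoduleOf_eq_top.2 ?_)
  intro c hc
  change spencerD 𝔤 W p 0 c = 0 at hc
  have h : c ![] = 0 := Prolongation.eq_zero_of_bracket_eq_zero W h𝔤 fun w hw => by
    have := spencerD_zero_apply W p c ![⟨w, hw⟩]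
    rw [hc] at this
    simpa using this.symm
  refine (Submodule.mem_bot ℝ).2 (AlternatingMap.ext fun x => ?_)
  rw [Subsingleton.elim x ![], h]
  rfl

/-- `H^{p+1,1}` vanishes as soon as every linear map `W → 𝔤^p` with symmetric bracket on `W` is
`w ↦ [T, w]` for some `T` in `𝔤^{p+1}`. The linear map is given through a linear extension to `V`,
which exists since the scalars form a field. -/
theorem subsingleton_spencerCohomology_one {p : ℕ}
    (h : ∀ C : V →ₗ[ℝ] Prolongation 𝔤 (p + 1), (∀ w ∈ W, ∀ w' ∈ W,
      prolongationBracket 𝔤 p w' (C w) = prolongationBracket 𝔤 p w (C w')) →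
      ∃ T : Prolongation 𝔤 (p + 2), ∀ w ∈ W, C w = prolongationBracket 𝔤 (p + 1) w T) :
    Subsingleton (SpencerCohomology 𝔤 W (p + 1) 1) := by
  refine Submodule.Quotient.subsingleton_iff.2 (Submodule.submoduleOf_eq_top.2 ?_)
  intro c hc
  change spencerD 𝔤 W p 1 c = 0 at hc
  obtain ⟨C, hC⟩ := (spencerOneEquiv 𝔤 W (p + 1) c).exists_extend
  have hCc : ∀ w : W, C w = c ![w] := fun w => by
    rw [← spencerOneEquiv_apply, ← hC]
    rfl
  obtain ⟨T, hT⟩ := h C fun w hw w' hw' => by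
    have := spencerD_one_apply W p c ![⟨w, hw⟩, ⟨w', hw'⟩]
    rw [hc] at this
    rw [hCc ⟨w, hw⟩, hCc ⟨w', hw'⟩]
    exact sub_eq_zero.1 this.symm
  exact (mem_spencerCoboundaries_one_iff W).2 ⟨T, fun w => by rw [← hCc, hT w w.2]⟩

variable (𝔤) in
theorem exists_spencerCohomology_zero_zero_equiv :
    ∃ e : SpencerCohomology 𝔤 W 0 0 ≃ₗ[ℝ] V, ∀ c : spencerCocycles 𝔤 W 0 0,
      e (spencerClass 𝔤 W 0 0 c) = spencerValue 𝔤 W c.1 ![] := by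
  let g : spencerCocycles 𝔤 W 0 0 ≃ₗ[ℝ] V :=
    LinearEquiv.ofTop _ rfl ≪≫ₗ AlternatingMap.constLinearEquivOfIsEmpty.symm ≪≫ₗ
      prolongationZeroEquiv 𝔤
  refine ⟨Submodule.quotEquivOfEqBot _ ?_ ≪≫ₗ g, fun c => ?_⟩
  · exact LinearMap.ker_eq_bot.2 Subtype.val_injective
  · change prolongationZeroEquiv 𝔤 (c.1 0) = prolongationZeroEquiv 𝔤 (c.1 ![])
    rw [Subsingleton.elim 0 ![]]

variable (𝔤) in
theorem exists_spencerCohomology_zero_one_equiv :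
    ∃ e : SpencerCohomology 𝔤 W 0 1 ≃ₗ[ℝ] (W →ₗ[ℝ] V) ⧸ restrictedAlgebra 𝔤 W,
      ∀ (c : spencerCocycles 𝔤 W 0 1) (f : W →ₗ[ℝ] V),
        (∀ w : W, f w = spencerValue 𝔤 W c.1 ![w]) →
          e (spencerClass 𝔤 W 0 1 c) = (restrictedAlgebra 𝔤 W).mkQ f := by
  let g : spencerCocycles 𝔤 W 0 1 ≃ₗ[ℝ] (W →ₗ[ℝ] V) :=
    LinearEquiv.ofTop _ rfl ≪≫ₗ spencerOneEquiv 𝔤 W 0 ≪≫ₗ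
      (LinearEquiv.refl ℝ W).arrowCongr (prolongationZeroEquiv 𝔤)
  have hg : ∀ c w, g c w = spencerValue 𝔤 W c.1 ![w] := fun c w =>
    congrArg (prolongationZeroEquiv 𝔤) (spencerOneEquiv_apply W c.1 w)
  refine ⟨Submodule.Quotient.equiv _ _ g ?_, fun c f hf => ?_⟩
  · ext f
    obtain ⟨c, rfl⟩ := g.surjective f
    have h1 : g c ∈ Submodule.map g.toLinearMap ((spencerCoboundaries 𝔤 W 0 1).submoduleOf
        (spencerCocycles 𝔤 W 0 1)) ↔ c.1 ∈ spencerCoboundaries 𝔤 W 0 1 :=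
      (Submodule.mem_map_equiv (e := g) _).trans (by rw [g.symm_apply_apply]; rfl)
    refine h1.trans ((mem_spencerCoboundaries_one_iff W).trans ⟨?_, ?_⟩)
    · rintro ⟨T, hT⟩
      refine ⟨_, prolongationOneToEnd_mem T, LinearMap.ext fun w => ?_⟩
      rw [hg]
      change prolongationOneToEnd 𝔤 T w = prolongationZeroEquiv 𝔤 (c.1 ![w])
      rw [prolongationOneToEnd_apply, hT]
    · rintro ⟨A, hA, hAg⟩
      obtain ⟨T, rfl⟩ := exists_prolongationOneToEnd_eq hA
      refine ⟨T, fun w => (prolongationZeroEquiv 𝔤).injective ?_⟩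
      rw [← prolongationOneToEnd_apply]
      exact ((hg c w).symm.trans (LinearMap.congr_fun hAg w).symm)
  · have : f = g c := LinearMap.ext fun w => (hf w).trans (hg c w).symm
    rw [this]
    rfl

end Prolongation

/-! ### Prolongation and Spencer cohomology in the quaternionic case -/

section Quaternionic

variable {n : ℕ}

/-- Exactness at `C^{1,1}`, with the additional information that the primitive is of the form
`covectorBilin ξ`. -/
theorem exists_bracket_eq_of_comm_one (hn : 2 ≤ n)
    (C : (Fin n → ℍ[ℝ]) →ₗ[ℝ] Prolongation (quaternionicAlgebra n) 1)
    (hC : ∀ w ∈ quaternionicHyperplane n, ∀ w' ∈ quaternionicHyperplane n,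
      prolongationBracket (quaternionicAlgebra n) 0 w' (C w) =
        prolongationBracket (quaternionicAlgebra n) 0 w (C w')) :
    ∃ T, (∃ ξ, ∀ v, prolongationOneToEnd _ (prolongationBracket (quaternionicAlgebra n) 1 v T) =
      covectorBilin ξ v) ∧
      ∀ w ∈ quaternionicHyperplane n, C w = prolongationBracket (quaternionicAlgebra n) 1 w T := by
  obtain ⟨ξ, hξ⟩ := exists_eq_covectorBilin hn (prolongationOneToEnd _ ∘ₗ C)
    (fun w _ => prolongationOneToEnd_mem _) (fun w hw w' hw' => by
      simp only [LinearMap.comp_apply, prolongationOneToEnd_apply, hC w hw w' hw'])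
  obtain ⟨T, hT⟩ := exists_prolongation_two_eq (covectorBilin ξ) (covectorBilin_mem ξ)
    (covectorBilin_comm ξ)
  refine ⟨T, ⟨ξ, hT⟩, fun w hw => prolongationOneToEnd_injective ?_⟩
  rw [hT, ← hξ w hw]
  rfl

/-- The first prolongation of `𝔤𝔩_n(ℍ) ⊕ 𝔰𝔭_1` consists of the maps `covectorBilin ξ`. -/
theorem exists_covectorBilin_eq_of_prolongation_two (hn : 2 ≤ n)
    (T : Prolongation (quaternionicAlgebra n) 2) :
    ∃ ξ, ∀ v, prolongationOneToEnd _ (prolongationBracket (quaternionicAlgebra n) 1 v T) =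
      covectorBilin ξ v := by
  obtain ⟨S, ⟨ξ, hS⟩, h⟩ := exists_bracket_eq_of_comm_one hn
    ((prolongationBracket (quaternionicAlgebra n) 1).flip T)
    fun w _ w' _ => prolongationBracket_comm _ 0 T w' w
  have hTS : T - S = 0 := Prolongation.eq_zero_of_bracket_eq_zero (quaternionicHyperplane n)
    (fun A => eq_zero_of_mem_quaternionicAlgebra) fun w hw => by
      rw [map_sub, ← h w hw]
      exact sub_self _
  exact ⟨ξ, sub_eq_zero.1 hTS ▸ hS⟩

/-- There are no non-zero cocycles in `C^{2,1}`. -/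
theorem eq_zero_of_comm_two (hn : 2 ≤ n)
    (C : (Fin n → ℍ[ℝ]) →ₗ[ℝ] Prolongation (quaternionicAlgebra n) 2)
    (hC : ∀ w ∈ quaternionicHyperplane n, ∀ w' ∈ quaternionicHyperplane n,
      prolongationBracket (quaternionicAlgebra n) 1 w' (C w) =
        prolongationBracket (quaternionicAlgebra n) 1 w (C w'))
    {w : Fin n → ℍ[ℝ]} (hw : w ∈ quaternionicHyperplane n) : C w = 0 := by
  choose ξ hξ using fun v => exists_covectorBilin_eq_of_prolongation_two hn (C v)
  refine C.eq_zero_of_mem_quaternionicHyperplane (fun i s hi => ?_) hw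
  have h0 := eq_zero_of_covectorBilin_comm hn (ξ := ξ)
    (fun w hw w' hw' => by rw [← hξ, ← hξ, hC w hw w' hw']) i s hi
  refine Prolongation.ext_bracket fun v => prolongationOneToEnd_injective ?_
  rw [hξ, h0, map_zero, map_zero]
  exact LinearMap.ext fun x => funext fun k => by simp [covectorBilin_apply]

/-- The second and all higher prolongations of `𝔤𝔩_n(ℍ) ⊕ 𝔰𝔭_1` vanish: the restriction to `W` of an
element of the second one is a cocycle in `C^{2,1}`. -/
theorem subsingleton_prolongation (hn : 2 ≤ n) (p : ℕ) :
    Subsingleton (Prolongation (quaternionicAlgebra n) (p + 3)) := by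
  refine subsingleton_of_forall_eq 0 fun T => ?_
  induction p with
  | zero =>
    exact Prolongation.eq_zero_of_bracket_eq_zero (quaternionicHyperplane n)
      (fun A => eq_zero_of_mem_quaternionicAlgebra) fun w hw =>
        eq_zero_of_comm_two hn ((prolongationBracket (quaternionicAlgebra n) 2).flip T)
          (fun w _ w' _ => prolongationBracket_comm _ 1 T w' w) hw
  | succ p ih =>
    exact Prolongation.ext_bracket fun v => by rw [ih (prolongationBracket _ _ v T), map_zero]

theorem subsingleton_quaternionic_spencerCohomology_one (hn : 2 ≤ n) (p : ℕ) :
    Subsingleton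
      (SpencerCohomology (quaternionicAlgebra n) (quaternionicHyperplane n) (p + 1) 1) := by
  refine subsingleton_spencerCohomology_one _ fun C hC => ?_
  match p, C, hC with
  | 0, C, hC =>
    obtain ⟨T, -, hT⟩ := exists_bracket_eq_of_comm_one hn C hC
    exact ⟨T, hT⟩
  | 1, C, hC => exact ⟨0, fun w hw => by rw [eq_zero_of_comm_two hn C hC hw, map_zero]⟩
  | p + 2, C, _ =>
    have := subsingleton_prolongation hn p
    exact ⟨0, fun w _ => Subsingleton.elim (α := Prolongation (quaternionicAlgebra n) (p + 3)) _ _⟩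

end Quaternionic

theorem proposition4p3 (n : ℕ) (hn : 2 ≤ n) :
    (∀ p : ℕ, 1 ≤ p →
      Subsingleton (SpencerCohomology (quaternionicAlgebra n) (quaternionicHyperplane n) p 0) ∧
      Subsingleton (SpencerCohomology (quaternionicAlgebra n) (quaternionicHyperplane n) p 1)) ∧
    (∃ e : SpencerCohomology (quaternionicAlgebra n) (quaternionicHyperplane n) 0 0 ≃ₗ[ℝ]
        (Fin n → ℍ[ℝ]),
      ∀ c : spencerCocycles (quaternionicAlgebra n) (quaternionicHyperplane n) 0 0,
        e (spencerClass (quaternionicAlgebra n) (quaternionicHyperplane n) 0 0 c) =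
          spencerValue (quaternionicAlgebra n) (quaternionicHyperplane n) c.1 ![]) ∧
    (∃ e : SpencerCohomology (quaternionicAlgebra n) (quaternionicHyperplane n) 0 1 ≃ₗ[ℝ]
        ((quaternionicHyperplane n →ₗ[ℝ] (Fin n → ℍ[ℝ])) ⧸
          restrictedAlgebra (quaternionicAlgebra n) (quaternionicHyperplane n)),
      ∀ (c : spencerCocycles (quaternionicAlgebra n) (quaternionicHyperplane n) 0 1)
        (f : quaternionicHyperplane n →ₗ[ℝ] (Fin n → ℍ[ℝ])),
        (∀ w : quaternionicHyperplane n, 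
            f w = spencerValue (quaternionicAlgebra n) (quaternionicHyperplane n) c.1 ![w]) →
          e (spencerClass (quaternionicAlgebra n) (quaternionicHyperplane n) 0 1 c) =
            (restrictedAlgebra (quaternionicAlgebra n) (quaternionicHyperplane n)).mkQ f) := by
  refine ⟨fun p hp => ?_, exists_spencerCohomology_zero_zero_equiv _ _,
    exists_spencerCohomology_zero_one_equiv _ _⟩
  obtain ⟨p, rfl⟩ := Nat.exists_eq_add_of_le' hp
  exact ⟨subsingleton_spencerCohomology_zero _ (fun A => eq_zero_of_mem_quaternionicAlgebra) p,
    subsingleton_quaternionic_spencerCohomology_one hn p⟩
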